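/- \textbf{Theorem.} Let $S_n$ be the symmetric group and $B_n=S_n\ltimes\mathbb{Z}_2^n$ the group of signed permutations $w=w_1\dots w_n$ of $[n]=\{1,\dots,n\}$, and put $w_0=0$. For $w\in B_n$ let $\mathrm{Des}(w)=\{i\in\{0,1,\dots,n-1\} : w_i>w_{i+1}\}$, with respect to the order $\cdots<\bar2<\bar1<0<1<2<\cdots$. For $J\subseteq\{0,1,\dots,n-1\}$ put, in the group algebra $\mathbb{Q}B_n$, \[ Y_J=\sum_{\mathrm{Des}(w)=J} w ,\qquad X_J=\sum_{I\subseteq J}Y_I=\sum_{\mathrm{Des}(w)\subseteq J} w . \] Let $\Sigma(B_n)\subseteq\mathbb{Q}B_n$ be Solomon's descent algebra of type $B$, the linear span of the $Y_J$; the $X_J$ form a linear basis of it. For $n\ge 1$ let $\beta:\Sigma(B_n)\to\Sigma(B_{n-1})$ be the linear map with \[ \beta(X_J)=X_{J-1}\ \text{ if } 0\notin J,\qquad \beta(X_J)=0\ \text{ if } 0\in J,\qquad\text{where } J-1=\{j-1 : j\in J\}. \] Let $I^0_n=\ker\beta$ for $n\ge1$, and $I^{0,1}_n=\ker(\beta^2)$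 for $n\ge 2$, where $\beta^2$ is the composite $\Sigma(B_n)\to\Sigma(B_{n-1})\to\Sigma(B_{n-2})$. Let $\varphi:\Sigma(B_n)\to\mathbb{Q}S_n$ be the restriction of the linear extension $\mathbb{Q}B_n\to\mathbb{Q}S_n$ of the group morphism $B_n\to S_n$ that forgets the signs. For $u=u_1\dots u_n\in S_n$ let $\overset{\circ}{\mathrm{Peak}}(u)=\{i\in\{2,\dots,n-1\} : u_{i-1}<u_i>u_{i+1}\}$ be its set of interior peaks, and let $\overset{\circ}{\mathfrak{P}}_n\subseteq\mathbb{Q}S_n$ (the peak ideal) be the linear span of the elements \[ \overset{\circ}{P}_F=\sum_{\overset{\circ}{\mathrm{Peak}}(u)=F}u , \] where $F$ runs over the subsets of $\{1,\dots,n-1\}$ that contain no two consecutive integers and do not contain $1$. Then $\varphi(I^0_n)=\overset{\circ}{\mathfrak{P}}_n$ for every $n\ge 1$, and $\varphi(I^{0,1}_n)=\varphi(I^0_n)=\overset{\circ}{\mathfrak{P}}_n$ for every $n\ge 2$. -/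

import Mathlib

open scoped BigOperators

noncomputable section

namespace PeakAlgebra

/-! ### Permutations and interior peaks -/

/-- The letters of the one-line notation `w₁ … wₙ` of a permutation `w` of `[n]` (here `[n]` is
modelled by `Fin n`, the symbol `a ∈ [n]` being `a - 1 : Fin n`), with `w₀ = 0`.  The value at
positions beyond `n` is never used. -/
def letter {n : ℕ} (w : Equiv.Perm (Fin n)) : ℕ → ℕ
  | 0 => 0
  | k + 1 => if h : k < n then (w ⟨k, h⟩ : ℕ) + 1 else 0

/-- The set of interior peaks: `{i ∈ {2, …, n-1} | w_{i-1} < w_i > w_{i+1}}`. -/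
def intPeak {n : ℕ} (w : Equiv.Perm (Fin n)) : Finset ℕ :=
  (Finset.Icc 2 (n - 1)).filter fun i =>
    letter w (i - 1) < letter w i ∧ letter w (i + 1) < letter w i

/-- The subsets `F` of `[n-1]` without two consecutive elements and with `1 ∉ F`. -/
def intPeakSets (n : ℕ) : Set (Finset ℕ) :=
  {F | F ⊆ Finset.Icc 1 (n - 1) ∧ (∀ i ∈ F, i + 1 ∉ F) ∧ 1 ∉ F}

/-- The rational group algebra of the symmetric group. -/
abbrev QS (n : ℕ) : Type := MonoidAlgebra ℚ (Equiv.Perm (Fin n))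

/-- The sum, in the group algebra, of all permutations whose set of interior peaks is `F`. -/
def intP (n : ℕ) (F : Finset ℕ) : QS n :=
  ∑ w : Equiv.Perm (Fin n) with intPeak w = F, MonoidAlgebra.of ℚ _ w

/-- The peak ideal: the linear span of the interior peak class sums. -/
def peakIdeal (n : ℕ) : Submodule ℚ (QS n) :=
  Submodule.span ℚ (intP n '' intPeakSets n)

/-! ### Signed permutations -/

/-- The group of signed permutations of `[n]`, as the semidirect product of `{±1}ⁿ` with the
symmetric group acting by permuting coordinates.  The element with sign vector `ε` and underlying
permutation `σ` is the signed permutation whose `i`-th letter is `ε (σ i) * σ i`. -/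
abbrev SignedPerm (n : ℕ) : Type :=
  SemidirectProduct (Fin n → ℤˣ) (Equiv.Perm (Fin n)) mulAutArrow

instance (n : ℕ) : Fintype (SignedPerm n) :=
  Fintype.ofEquiv _ SemidirectProduct.equivProd.symm

/-- The letters of a signed permutation `w₁ … wₙ`, a barred symbol being a negative integer, with
`w₀ = 0`.  The value at positions beyond `n` is never used. -/
def signedLetter {n : ℕ} (w : SignedPerm n) : ℕ → ℤ
  | 0 => 0
  | k + 1 =>
    if h : k < n then (w.left (w.right ⟨k, h⟩) : ℤ) * ((w.right ⟨k, h⟩ : ℕ) + 1) else 0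

/-- The descent set of type B, a subset of `{0, 1, …, n-1}` (modelled by `Fin n`):
`i` is a descent when `w_i > w_{i+1}`. -/
def desB {n : ℕ} (w : SignedPerm n) : Finset (Fin n) :=
  Finset.univ.filter fun i => signedLetter w ((i : ℕ) + 1) < signedLetter w (i : ℕ)

/-- The rational group algebra of the group of signed permutations. -/
abbrev QB (n : ℕ) : Type := MonoidAlgebra ℚ (SignedPerm n)

/-- `Y_J`: the sum of all signed permutations with descent set `J`. -/
def Y {n : ℕ} (J : Finset (Fin n)) : QB n :=
  ∑ w : SignedPerm n with desB w = J, MonoidAlgebra.of ℚ _ w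

/-- Solomon's descent algebra of type `B_n`, as a linear subspace of the group algebra. -/
def SolB (n : ℕ) : Submodule ℚ (QB n) :=
  Submodule.span ℚ (Set.range (Y (n := n)))

/-- `X_J`: the sum of all `Y_I` with `I ⊆ J`. -/
def X {n : ℕ} (J : Finset (Fin n)) : QB n :=
  ∑ I ∈ J.powerset, Y I

/-! ### The elements `X_J` form a basis of the descent algebra -/

/-- Every subset of `{0, …, n-1}` is the descent set of a signed permutation. -/
theorem exists_desB_eq {n : ℕ} (J : Finset (Fin n)) : ∃ w : SignedPerm n, desB w = J := by
  classical
  refine ⟨⟨fun i => if i ∈ J then -1 else 1, 1⟩, ?_⟩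
  ext i
  obtain ⟨i, hi⟩ := i
  have key : ∀ k : ℕ, ∀ hk : k < n,
      signedLetter (⟨fun i => if i ∈ J then -1 else 1, 1⟩ : SignedPerm n) (k + 1)
        = if (⟨k, hk⟩ : Fin n) ∈ J then -((k : ℤ) + 1) else (k : ℤ) + 1 := by
    intro k hk
    have hs : signedLetter (⟨fun i => if i ∈ J then -1 else 1, 1⟩ : SignedPerm n) (k + 1)
        = (((if (⟨k, hk⟩ : Fin n) ∈ J then -1 else 1 : ℤˣ) : ℤˣ) : ℤ) * ((k : ℤ) + 1) :=
      dif_pos hk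
    rw [hs]
    split_ifs <;> simp
  simp only [desB, Finset.mem_filter, Finset.mem_univ, true_and]
  rw [key i hi]
  cases i with
  | zero => simp only [signedLetter]; split_ifs with h <;> simp [h]
  | succ k =>
    rw [key k (by omega)]
    split_ifs with h h' <;> simp only [h, iff_true, iff_false] <;> push_cast <;> omega

theorem coeff_Y {n : ℕ} (J : Finset (Fin n)) (w : SignedPerm n) :
    (Y J).coeff w = if desB w = J then 1 else 0 := by
  classical
  simp [Y, MonoidAlgebra.coeff_sum, MonoidAlgebra.of_apply, Finsupp.single_apply]

theorem linearIndependent_Y (n : ℕ) : LinearIndependent ℚ (Y (n := n)) := by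
  classical
  rw [Fintype.linearIndependent_iff]
  intro g hg J
  obtain ⟨w, hw⟩ := exists_desB_eq J
  have := congrArg (fun x => MonoidAlgebra.coeff x w) hg
  simpa [MonoidAlgebra.coeff_sum, coeff_Y, hw] using this

theorem coeff_X {n : ℕ} (J : Finset (Fin n)) (w : SignedPerm n) :
    (X J).coeff w = if desB w ⊆ J then 1 else 0 := by
  classical
  simp [X, MonoidAlgebra.coeff_sum, coeff_Y]

theorem linearIndependent_X (n : ℕ) : LinearIndependent ℚ (X (n := n)) := by
  classical
  rw [Fintype.linearIndependent_iff]
  intro g hg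
  have h : ∀ I : Finset (Fin n), ∑ J, (if I ⊆ J then g J else 0) = 0 := by
    intro I
    obtain ⟨w, hw⟩ := exists_desB_eq I
    have := congrArg (fun x => MonoidAlgebra.coeff x w) hg
    simpa [MonoidAlgebra.coeff_sum, coeff_X, hw] using this
  intro I
  induction I using WellFoundedGT.induction with
  | ind I ih =>
    have hI := h I
    rw [Finset.sum_eq_single I] at hI
    · simpa using hI
    · intro J _ hJ
      split_ifs with hIJ
      · exact ih J (lt_of_le_of_ne hIJ (Ne.symm hJ))
      · rfl
    · simp

theorem X_mem {n : ℕ} (J : Finset (Fin n)) : X J ∈ SolB n :=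
  Submodule.sum_mem _ fun I _ => Submodule.subset_span ⟨I, rfl⟩

theorem card_eq_finrank_SolB (n : ℕ) :
    Fintype.card (Finset (Fin n)) = Module.finrank ℚ (SolB n) :=
  (finrank_span_eq_card (linearIndependent_Y n)).symm

/-- The basis `X_J`, `J ⊆ {0, …, n-1}`, of the descent algebra of type B. -/
def XBasis (n : ℕ) : Module.Basis (Finset (Fin n)) ℚ (SolB n) :=
  basisOfLinearIndependentOfCardEqFinrank
    (b := fun J => (⟨X J, X_mem J⟩ : SolB n))
    (LinearIndependent.of_comp (SolB n).subtype (linearIndependent_X n))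
    (card_eq_finrank_SolB n)

theorem coe_XBasis {n : ℕ} (J : Finset (Fin n)) : (XBasis n J : QB n) = X J := by
  rw [XBasis, coe_basisOfLinearIndependentOfCardEqFinrank]

/-! ### The maps and the ideals -/

/-- The shifted set `J - 1 = {i | i + 1 ∈ J}`, for a subset `J` of `{0, …, n}` (the element `0`,
if it belongs to `J`, is discarded). -/
def shiftDown {n : ℕ} (J : Finset (Fin (n + 1))) : Finset (Fin n) :=
  Finset.univ.filter fun i => i.succ ∈ J

/-- The linear map from the descent algebra of `B_{n+1}` to that of `B_n` with
`X_J ↦ X_{J-1}` if `0 ∉ J` and `X_J ↦ 0` if `0 ∈ J`. -/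
def beta (n : ℕ) : SolB (n + 1) →ₗ[ℚ] SolB n :=
  (XBasis (n + 1)).constr ℚ fun J => if (0 : Fin (n + 1)) ∈ J then 0 else XBasis n (shiftDown J)

/-- The canonical ideal `I⁰_{n+1}` of the descent algebra of `B_{n+1}`. -/
def idealI0 (n : ℕ) : Submodule ℚ (SolB (n + 1)) :=
  LinearMap.ker (beta n)

/-- The ideal `I^{0,1}_{n+2}` of the descent algebra of `B_{n+2}`: the kernel of the composite of
`beta` from `B_{n+2}` to `B_{n+1}` with `beta` from `B_{n+1}` to `B_n`. -/
def idealI01 (n : ℕ) : Submodule ℚ (SolB (n + 2)) :=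
  LinearMap.ker (beta n ∘ₗ beta (n + 1))

/-- The map of group algebras induced by the group morphism that forgets the signs. -/
def forgetSigns (n : ℕ) : QB n →ₐ[ℚ] QS n :=
  MonoidAlgebra.mapDomainAlgHom ℚ ℚ (SemidirectProduct.rightHom : SignedPerm n →* _)

/-- The restriction `φ` of the sign-forgetting map to the descent algebra of type B. -/
def phi (n : ℕ) : SolB n →ₗ[ℚ] QS n :=
  (forgetSigns n).toLinearMap ∘ₗ (SolB n).subtype

end PeakAlgebra

end

open scoped BigOperators

noncomputable section

namespace PeakAlgebra

/-! ### Letters and peaks -/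

theorem letter_succ {n : ℕ} (u : Equiv.Perm (Fin n)) (i : Fin n) :
    letter u ((i : ℕ) + 1) = (u i : ℕ) + 1 :=
  dif_pos i.2

theorem letter_ne_letter_succ {n : ℕ} (u : Equiv.Perm (Fin n)) (i : Fin n) :
    letter u (i : ℕ) ≠ letter u ((i : ℕ) + 1) := by
  rw [letter_succ]
  obtain ⟨i, hi⟩ := i
  cases i with
  | zero => simp [letter]
  | succ k =>
    have hk : k < n := by omega
    have h1 : letter u (k + 1) = (u ⟨k, hk⟩ : ℕ) + 1 := dif_pos hk
    simp only [h1, ne_eq, Nat.add_right_cancel_iff]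
    intro h
    have := u.injective (Fin.ext h)
    simp at this

theorem intPeak_mem_intPeakSets {n : ℕ} (u : Equiv.Perm (Fin n)) : intPeak u ∈ intPeakSets n := by
  refine ⟨fun i hi => ?_, fun i hi hi' => ?_, fun h => ?_⟩
  · simp only [intPeak, Finset.mem_filter, Finset.mem_Icc] at hi ⊢
    omega
  · simp only [intPeak, Finset.mem_filter, Finset.mem_Icc, Nat.add_sub_cancel] at hi hi'
    omega
  · simp [intPeak] at h

theorem intP_eq_zero {n : ℕ} {F : Finset ℕ} (hF : F ∉ intPeakSets n) : intP n F = 0 := by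
  rw [intP, Finset.filter_false_of_mem, Finset.sum_empty]
  rintro u - rfl
  exact hF (intPeak_mem_intPeakSets u)

theorem intP_mem_peakIdeal (n : ℕ) (F : Finset ℕ) : intP n F ∈ peakIdeal n := by
  by_cases hF : F ∈ intPeakSets n
  · exact Submodule.subset_span ⟨F, hF, rfl⟩
  · rw [intP_eq_zero hF]
    exact zero_mem _

theorem sum_intP_powerset (n : ℕ) (A : Finset ℕ) :
    ∑ F ∈ A.powerset, intP n F =
      ∑ u : Equiv.Perm (Fin n) with intPeak u ⊆ A, MonoidAlgebra.of ℚ _ u := by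
  rw [← Finset.sum_fiberwise_of_maps_to (s := Finset.univ.filter fun u => intPeak u ⊆ A)
    (t := A.powerset) (g := intPeak) (fun u hu => by simpa using hu)]
  refine Finset.sum_congr rfl fun F hF => ?_
  rw [intP, Finset.filter_filter]
  refine Finset.sum_congr (Finset.filter_congr fun u _ => ?_) fun _ _ => rfl
  rw [Finset.mem_powerset] at hF
  exact ⟨fun h => ⟨h ▸ hF, h⟩, fun h => h.2⟩

/-! ### Sign choices whose descents lie in a given set -/

/-- Of the positions `i` and `i + 1`, the one carrying the larger letter of `u`; the `k`-th position
is modelled by `k - 1 : Fin n`. -/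
def largerPos {n : ℕ} (u : Equiv.Perm (Fin n)) (i : Fin n) : Fin n :=
  if letter u (i : ℕ) < letter u ((i : ℕ) + 1) then i else ⟨(i : ℕ) - 1, by omega⟩

/-- The sign which the larger of the letters in positions `i` and `i + 1` must carry for `i` not to
be a descent. -/
def forcedSign {n : ℕ} (u : Equiv.Perm (Fin n)) (i : Fin n) : ℤˣ :=
  if letter u (i : ℕ) < letter u ((i : ℕ) + 1) then 1 else -1

theorem notMem_desB_iff {n : ℕ} (w : SignedPerm n) (i : Fin n) :
    i ∉ desB w ↔ w.left (w.right (largerPos w.right i)) = forcedSign w.right i := by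
  have hs : ∀ k : Fin n, signedLetter w ((k : ℕ) + 1) =
      (w.left (w.right k) : ℤ) * ((w.right k : ℕ) + 1) := fun k => dif_pos k.2
  have hne := letter_ne_letter_succ w.right i
  simp only [desB, Finset.mem_filter, Finset.mem_univ, true_and, largerPos, forcedSign, hs]
  rw [letter_succ] at hne ⊢
  obtain ⟨i, hi⟩ := i
  cases i with
  | zero =>
    simp only [letter, signedLetter, Nat.succ_pos, if_true]
    rcases Int.units_eq_one_or (w.left (w.right ⟨0, hi⟩)) with h | h <;> rw [h] <;> simp <;> omega
  | succ k =>
    have hk : k < n := by omega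
    have h1 := letter_succ w.right ⟨k, hk⟩
    have h2 := hs ⟨k, hk⟩
    simp only at h1 h2 hne ⊢
    rw [h2]
    rw [h1] at hne ⊢
    split_ifs with h <;>
    rcases Int.units_eq_one_or (w.left (w.right ⟨k, hk⟩)) with h3 | h3 <;>
    rcases Int.units_eq_one_or (w.left (w.right ⟨k + 1, hi⟩)) with h4 | h4 <;>
    simp [h3, h4] <;> omega

theorem desB_subset_iff {n : ℕ} (w : SignedPerm n) (J : Finset (Fin n)) :
    desB w ⊆ J ↔
      ∀ i : {i // i ∉ J}, w.left (w.right (largerPos w.right i)) = forcedSign w.right i := by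
  simp only [← notMem_desB_iff, Subtype.forall]
  exact forall_congr' fun i => not_imp_not.symm

/-- The union of `J` and `J + 1`. -/
def cover {n : ℕ} (J : Finset (Fin n)) : Finset ℕ :=
  J.image (fun i : Fin n => (i : ℕ)) ∪ J.image fun i : Fin n => (i : ℕ) + 1

theorem largerPos_injective {n : ℕ} {u : Equiv.Perm (Fin n)} {J : Finset (Fin n)}
    (hJ : ∃ i ∈ J, (i : ℕ) ≤ 1) (h : intPeak u ⊆ cover J) :
    Function.Injective fun i : {i // i ∉ J} => largerPos u i := by
  have key : ∀ i j : Fin n, i ∉ J → j ∉ J → i < j → largerPos u i ≠ largerPos u j := by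
    intro i j hi hj hij he
    have hv : (i : ℕ) < j := hij
    rw [Fin.ext_iff] at he
    simp only [largerPos] at he
    split_ifs at he with h1 h2 h2
    · omega
    · simp only at he
      have hne := letter_ne_letter_succ u j
      have hji : (j : ℕ) = i + 1 := by omega
      rw [hji] at hne h2
      by_cases h0 : (i : ℕ) = 0
      · obtain ⟨k, hk, hk1⟩ := hJ
        rcases Nat.lt_or_ge (k : ℕ) 1 with hk' | hk'
        · exact hi ((Fin.ext (by omega) : k = i) ▸ hk)
        · exact hj ((Fin.ext (by omega) : k = j) ▸ hk)
      · have hp : (i : ℕ) + 1 ∈ intPeak u := by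
          simp only [intPeak, Finset.mem_filter, Finset.mem_Icc, Nat.add_sub_cancel]
          omega
        have hc := h hp
        simp only [cover, Finset.mem_union, Finset.mem_image] at hc
        rcases hc with ⟨k, hk, hki⟩ | ⟨k, hk, hki⟩
        · exact hj ((Fin.ext (by omega) : k = j) ▸ hk)
        · exact hi ((Fin.ext (by omega) : k = i) ▸ hk)
    · simp only at he; omega
    · simp only at he
      have : (i : ℕ) = 0 := by omega
      rw [this, letter, zero_add] at h1
      have h3 := letter_succ u i
      rw [this, zero_add] at h3
      omega
  rintro ⟨i, hi⟩ ⟨j, hj⟩ he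
  rcases lt_trichotomy i j with h' | h' | h'
  · exact absurd he (key i j hi hj h')
  · exact Subtype.ext h'
  · exact absurd he.symm (key j i hj hi h')

theorem intPeak_subset_cover {n : ℕ} {u : Equiv.Perm (Fin n)} {J : Finset (Fin n)}
    {s : Fin n → ℤˣ} (hs : ∀ i : {i // i ∉ J}, s (largerPos u i) = forcedSign u i) :
    intPeak u ⊆ cover J := by
  intro p hp
  simp only [intPeak, Finset.mem_filter, Finset.mem_Icc] at hp
  obtain ⟨⟨hp2, hpn⟩, h1, h2⟩ := hp
  obtain ⟨q, rfl⟩ : ∃ q, p = q + 1 := ⟨p - 1, by omega⟩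
  rw [Nat.add_sub_cancel] at h1
  by_contra hc
  simp only [cover, Finset.mem_union, Finset.mem_image, not_or, not_exists, not_and] at hc
  have ha := hs ⟨⟨q, by omega⟩, fun h => hc.2 _ h rfl⟩
  have hb := hs ⟨⟨q + 1, by omega⟩, fun h => hc.1 _ h rfl⟩
  simp only [largerPos, forcedSign, h1, h2.not_gt, if_true, if_false, Nat.add_sub_cancel] at ha hb
  rw [ha] at hb
  exact absurd hb (by decide)

theorem card_extensions {α β γ : Type*} [Fintype α] [Fintype β] [DecidableEq β] [Fintype γ]
    [DecidableEq γ] [Nonempty γ] {m : α → β} (hm : Function.Injective m) (v : α → γ) :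
    (Finset.univ.filter fun s : β → γ => ∀ a, s (m a) = v a).card =
      Fintype.card γ ^ (Fintype.card β - Fintype.card α) := by
  classical
  have h : (Finset.univ.filter fun s : β → γ => ∀ a, s (m a) = v a) =
      Fintype.piFinset fun b => if b ∈ Finset.univ.image m then
        {Function.extend m v (fun _ => Classical.arbitrary γ) b} else Finset.univ := by
    ext s
    simp only [Finset.mem_filter, Finset.mem_univ, true_and, Fintype.mem_piFinset,
      Finset.mem_image]
    constructor
    · intro hs b
      split_ifs with hb
      · obtain ⟨a, rfl⟩ := hb
        simp [hm.extend_apply, hs]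
      · simp
    · intro hs a
      have := hs (m a)
      rw [if_pos ⟨a, rfl⟩, hm.extend_apply] at this
      simpa using this
  rw [h, Fintype.card_piFinset]
  have : ∀ b, (if b ∈ Finset.univ.image m then
      {Function.extend m v (fun _ => Classical.arbitrary γ) b} else Finset.univ : Finset γ).card =
      if b ∈ Finset.univ.image m then 1 else Fintype.card γ := fun b => by
    split_ifs <;> simp
  rw [Finset.prod_congr rfl fun b _ => this b, Finset.prod_ite, Finset.prod_const_one, one_mul,
    Finset.prod_const, Finset.filter_not, Finset.filter_mem_eq_inter, Finset.univ_inter,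
    Finset.card_sdiff_of_subset (Finset.subset_univ _), Finset.card_image_of_injective _ hm,
    Finset.card_univ, Finset.card_univ]

theorem card_signs {n : ℕ} (u : Equiv.Perm (Fin n)) {J : Finset (Fin n)}
    (hJ : ∃ i ∈ J, (i : ℕ) ≤ 1) :
    (Finset.univ.filter fun e : Fin n → ℤˣ => desB (⟨e, u⟩ : SignedPerm n) ⊆ J).card =
      if intPeak u ⊆ cover J then 2 ^ J.card else 0 := by
  simp only [desB_subset_iff]
  split_ifs with h
  · have hc := card_extensions (m := fun i : {i // i ∉ J} => u (largerPos u i))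
      (u.injective.comp (largerPos_injective hJ h)) (fun i : {i // i ∉ J} => forcedSign u i)
    have hcard : Fintype.card {i // i ∉ J} = n - J.card := by
      rw [Fintype.card_subtype_compl]; simp
    have hle : J.card ≤ n := by simpa using J.card_le_univ
    rw [hc, hcard, Fintype.card_fin, Nat.sub_sub_self hle]
    rfl
  · rw [Finset.card_eq_zero, Finset.filter_eq_empty_iff]
    exact fun e _ he => h (intPeak_subset_cover (s := e ∘ u) he)

/-! ### The image of `X_J` -/

theorem X_eq_sum {n : ℕ} (J : Finset (Fin n)) :
    X J = ∑ w : SignedPerm n, if desB w ⊆ J then MonoidAlgebra.of ℚ _ w else 0 := by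
  classical
  rw [← Finset.sum_filter, X, ← Finset.sum_fiberwise_of_maps_to
    (s := Finset.univ.filter fun w : SignedPerm n => desB w ⊆ J)
    (t := J.powerset) (g := desB) (fun u hu => by simpa using hu)]
  refine Finset.sum_congr rfl fun F hF => ?_
  rw [Y, Finset.filter_filter]
  refine Finset.sum_congr (Finset.filter_congr fun u _ => ?_) fun _ _ => rfl
  rw [Finset.mem_powerset] at hF
  exact ⟨fun h => ⟨h ▸ hF, h⟩, fun h => h.2⟩

theorem phi_XBasis {n : ℕ} {J : Finset (Fin n)} (hJ : ∃ i ∈ J, (i : ℕ) ≤ 1) :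
    phi n (XBasis n J) = (2 : ℚ) ^ J.card • ∑ F ∈ (cover J).powerset, intP n F := by
  have h0 : phi n (XBasis n J) = forgetSigns n (X J) := by
    rw [← coe_XBasis]; rfl
  have h1 : ∀ w : SignedPerm n, forgetSigns n (if desB w ⊆ J then MonoidAlgebra.of ℚ _ w else 0) =
      if desB w ⊆ J then MonoidAlgebra.of ℚ _ w.right else 0 := fun w => by
    split_ifs
    · simp [forgetSigns, MonoidAlgebra.of_apply]
    · exact map_zero _
  rw [h0, X_eq_sum, map_sum, Finset.sum_congr rfl fun w _ => h1 w, sum_intP_powerset,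
    ← SemidirectProduct.equivProd.symm.sum_comp, Fintype.sum_prod_type_right, Finset.sum_filter,
    Finset.smul_sum]
  refine Finset.sum_congr rfl fun u _ => ?_
  have h2 := card_signs u hJ
  change ∑ e : Fin n → ℤˣ, (if desB (⟨e, u⟩ : SignedPerm n) ⊆ J then
    MonoidAlgebra.of ℚ (Equiv.Perm (Fin n)) u else 0) = _
  rw [← Finset.sum_filter, Finset.sum_const, h2]
  split_ifs
  · rw [← Nat.cast_smul_eq_nsmul ℚ]; push_cast; rfl
  · simp

theorem phi_XBasis_mem {n : ℕ} {J : Finset (Fin n)} (hJ : ∃ i ∈ J, (i : ℕ) ≤ 1) :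
    phi n (XBasis n J) ∈ peakIdeal n := by
  rw [phi_XBasis hJ]
  exact Submodule.smul_mem _ _ (Submodule.sum_mem _ fun F _ => intP_mem_peakIdeal n F)

/-! ### Kernels -/

theorem repr_eq_zero_of_apply_eq_zero {R M N ι : Type*} [Ring R] [AddCommGroup M] [AddCommGroup N]
    [Module R M] [Module R N] [Fintype ι] (b : Module.Basis ι R M) (T : M →ₗ[R] N) (p : ι → Prop)
    (h0 : ∀ i, p i → T (b i) = 0) (hli : LinearIndependent R fun i : {i // ¬p i} => T (b i))
    {x : M} (hx : T x = 0) {i : ι} (hi : ¬p i) : b.repr x i = 0 := by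
  classical
  rw [Fintype.linearIndependent_iff] at hli
  have h : ∑ i, T (b.repr x i • b i) = 0 := by rw [← map_sum, b.sum_repr, hx]
  rw [← Fintype.sum_subtype_add_sum_subtype p, Finset.sum_eq_zero, zero_add] at h
  · exact hli (fun i => b.repr x i) (by simpa using h) ⟨i, hi⟩
  · rintro ⟨j, hj⟩ -
    simp [h0 j hj]

theorem map_ker_le_of_basis {R M N P ι : Type*} [Ring R] [AddCommGroup M] [AddCommGroup N]
    [AddCommGroup P] [Module R M] [Module R N] [Module R P] [Fintype ι] (b : Module.Basis ι R M)
    (T : M →ₗ[R] N) (p : ι → Prop) (h0 : ∀ i, p i → T (b i) = 0)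
    (hli : LinearIndependent R fun i : {i // ¬p i} => T (b i)) (f : M →ₗ[R] P)
    (Q : Submodule R P) (hf : ∀ i, p i → f (b i) ∈ Q) : (LinearMap.ker T).map f ≤ Q := by
  rintro _ ⟨x, hx, rfl⟩
  rw [← b.sum_repr x, map_sum]
  refine Submodule.sum_mem _ fun i _ => ?_
  rw [map_smul]
  by_cases hi : p i
  · exact Submodule.smul_mem _ _ (hf i hi)
  · rw [repr_eq_zero_of_apply_eq_zero b T p h0 hli hx hi, zero_smul]
    exact zero_mem _

theorem beta_XBasis_of_mem {n : ℕ} {J : Finset (Fin (n + 1))} (hJ : 0 ∈ J) :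
    beta n (XBasis (n + 1) J) = 0 := by
  rw [beta, Module.Basis.constr_basis, if_pos hJ]

theorem beta_XBasis_of_notMem {n : ℕ} {J : Finset (Fin (n + 1))} (hJ : 0 ∉ J) :
    beta n (XBasis (n + 1) J) = XBasis n (shiftDown J) := by
  rw [beta, Module.Basis.constr_basis, if_neg hJ]

theorem mem_shiftDown {n : ℕ} {J : Finset (Fin (n + 1))} {i : Fin n} :
    i ∈ shiftDown J ↔ i.succ ∈ J := by
  simp [shiftDown]

theorem shiftDown_inj {n : ℕ} {J K : Finset (Fin (n + 1))} (hJ : 0 ∉ J) (hK : 0 ∉ K)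
    (h : shiftDown J = shiftDown K) : J = K := by
  ext i
  cases i using Fin.cases with
  | zero => simp [hJ, hK]
  | succ i => rw [← mem_shiftDown, h, mem_shiftDown]

theorem map_idealI0_le (n : ℕ) : (idealI0 n).map (phi (n + 1)) ≤ peakIdeal (n + 1) := by
  refine map_ker_le_of_basis (XBasis (n + 1)) (beta n) (fun J => 0 ∈ J)
    (fun J hJ => beta_XBasis_of_mem hJ) ?_ _ _ fun J hJ => phi_XBasis_mem ⟨0, hJ, by simp⟩
  have : (fun J : {J : Finset (Fin (n + 1)) // 0 ∉ J} => beta n (XBasis (n + 1) J)) =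
      XBasis n ∘ fun J => shiftDown J.1 := funext fun J => beta_XBasis_of_notMem J.2
  rw [this]
  exact (XBasis n).linearIndependent.comp _ fun J K h => Subtype.ext (shiftDown_inj J.2 K.2 h)

theorem map_idealI01_le (n : ℕ) : (idealI01 n).map (phi (n + 2)) ≤ peakIdeal (n + 2) := by
  refine map_ker_le_of_basis (XBasis (n + 2)) (beta n ∘ₗ beta (n + 1)) (fun J => 0 ∈ J ∨ 1 ∈ J)
    (fun J hJ => ?_) ?_ _ _ fun J hJ => phi_XBasis_mem ?_
  · by_cases h0 : 0 ∈ J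
    · rw [LinearMap.comp_apply, beta_XBasis_of_mem h0, map_zero]
    · rw [LinearMap.comp_apply, beta_XBasis_of_notMem h0]
      exact beta_XBasis_of_mem (mem_shiftDown.2 (hJ.resolve_left h0))
  · have hs : ∀ J : {J : Finset (Fin (n + 2)) // ¬(0 ∈ J ∨ 1 ∈ J)}, 0 ∉ shiftDown J.1 :=
      fun J h => J.2 (Or.inr (mem_shiftDown.1 h))
    have : (fun J : {J : Finset (Fin (n + 2)) // ¬(0 ∈ J ∨ 1 ∈ J)} =>
        (beta n ∘ₗ beta (n + 1)) (XBasis (n + 2) J)) =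
        XBasis n ∘ fun J => shiftDown (shiftDown J.1) := funext fun J => by
      rw [LinearMap.comp_apply, beta_XBasis_of_notMem fun h => J.2 (Or.inl h),
        beta_XBasis_of_notMem (hs J)]
      rfl
    rw [this]
    exact (XBasis n).linearIndependent.comp _ fun J K h => Subtype.ext <|
      shiftDown_inj (fun h => J.2 (Or.inl h)) (fun h => K.2 (Or.inl h)) <|
        shiftDown_inj (hs J) (hs K) h
  · rcases hJ with h | h
    · exact ⟨0, h, by simp⟩
    · exact ⟨1, h, by simp⟩

theorem idealI0_le_idealI01 (n : ℕ) : idealI0 (n + 1) ≤ idealI01 n :=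
  LinearMap.ker_le_ker_comp _ _

/-! ### Triangularity -/

theorem sum_lt_sum_of_shifted {F G : Finset ℕ} (hG : ∀ g ∈ G, g + 1 ∉ G) (h0 : 0 ∉ F)
    (hGF : ∀ g ∈ G, g ∈ F ∨ g + 1 ∈ F) (hne : G ≠ F) : ∑ g ∈ G, g < ∑ f ∈ F, f := by
  let r : ℕ → ℕ := fun g => if g ∈ F then g else g + 1
  have hinj : Set.InjOn r G := by
    intro a ha b hb hab
    simp only [r] at hab
    split_ifs at hab with h1 h2 h2
    · exact hab
    · exact absurd (hab ▸ ha) (hG b hb)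
    · exact absurd (hab ▸ hb) (hG a ha)
    · omega
  have hsub : G.image r ⊆ F := by
    intro f hf
    obtain ⟨g, hg, rfl⟩ := Finset.mem_image.1 hf
    simp only [r]
    split_ifs with h
    · exact h
    · exact (hGF g hg).resolve_left h
  have hle : ∀ g ∈ G, g ≤ r g := fun g _ => by
    simp only [r]; split_ifs <;> omega
  have hsum : ∑ g ∈ G, r g = ∑ f ∈ G.image r, f := (Finset.sum_image (f := fun f => f) hinj).symm
  by_cases hsubset : G ⊆ F
  · obtain ⟨f, hf, hfG⟩ := Finset.exists_of_ssubset (hsubset.ssubset_of_ne hne)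
    exact Finset.sum_lt_sum_of_subset hsubset hf hfG
      (Nat.pos_of_ne_zero fun h => h0 (h ▸ hf)) fun _ _ _ => Nat.zero_le _
  · obtain ⟨g, hg, hgF⟩ := Finset.not_subset.1 hsubset
    calc ∑ g ∈ G, g < ∑ g ∈ G, r g := Finset.sum_lt_sum hle ⟨g, hg, by simp [r, hgF]⟩
      _ ≤ ∑ f ∈ F, f := hsum ▸ Finset.sum_le_sum_of_subset hsub

theorem intP_mem_map_idealI0 (n : ℕ) (F : Finset ℕ) :
    intP (n + 1) F ∈ (idealI0 n).map (phi (n + 1)) := by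
  induction hN : ∑ f ∈ F, f using Nat.strong_induction_on generalizing F with
  | _ N ih =>
  by_cases hF : F ∈ intPeakSets (n + 1)
  swap
  · rw [intP_eq_zero hF]
    exact zero_mem _
  obtain ⟨hFn, hF2, hF1⟩ := hF
  have hFn' : ∀ f ∈ F, 1 ≤ f ∧ f ≤ n := fun f hf => by simpa using hFn hf
  let J : Finset (Fin (n + 1)) := Finset.univ.filter fun i => i = 0 ∨ (i : ℕ) + 1 ∈ F
  have h0J : (0 : Fin (n + 1)) ∈ J := by simp [J]
  have hFJ : F ∈ (cover J).powerset := by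
    rw [Finset.mem_powerset]
    intro f hf
    have := hFn' f hf
    refine Finset.mem_union_right _ (Finset.mem_image.2 ⟨⟨f - 1, by omega⟩, ?_, ?_⟩)
    · simp only [J, Finset.mem_filter, Finset.mem_univ, true_and, Nat.sub_add_cancel this.1]
      exact Or.inr hf
    · exact Nat.sub_add_cancel this.1
  have hphi := phi_XBasis (J := J) ⟨0, h0J, by simp⟩
  have hmem : phi (n + 1) (XBasis (n + 1) J) ∈ (idealI0 n).map (phi (n + 1)) :=
    ⟨_, beta_XBasis_of_mem h0J, rfl⟩
  rw [hphi, Submodule.smul_mem_iff _ (by positivity), ← Finset.add_sum_erase _ _ hFJ] at hmem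
  refine (Submodule.add_mem_iff_left _ (Submodule.sum_mem _ fun G hG => ?_)).1 hmem
  by_cases hGp : G ∈ intPeakSets (n + 1)
  swap
  · rw [intP_eq_zero hGp]
    exact zero_mem _
  obtain ⟨hGn, hG2, hG1⟩ := hGp
  rw [Finset.mem_erase, Finset.mem_powerset] at hG
  refine ih _ (hN ▸ sum_lt_sum_of_shifted hG2 (fun h => ?_) (fun g hg => ?_) hG.1) G rfl
  · have := hFn' 0 h
    omega
  · have hg1 : 1 ≤ g := (Finset.mem_Icc.1 (hGn hg)).1
    have hg2 : g ≠ 1 := fun h => hG1 (h ▸ hg)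
    have hgc := hG.2 hg
    simp only [cover, J, Finset.mem_union, Finset.mem_image, Finset.mem_filter, Finset.mem_univ,
      true_and] at hgc
    rcases hgc with ⟨i, rfl | hi, rfl⟩ | ⟨i, rfl | hi, rfl⟩
    · simp at hg1
    · exact Or.inr hi
    · simp at hg2
    · exact Or.inl hi

theorem map_idealI0 (n : ℕ) : (idealI0 n).map (phi (n + 1)) = peakIdeal (n + 1) := by
  refine le_antisymm (map_idealI0_le n) (Submodule.span_le.2 ?_)
  rintro _ ⟨F, -, rfl⟩
  exact intP_mem_map_idealI0 n F

theorem map_idealI01 (n : ℕ) : (idealI01 n).map (phi (n + 2)) = peakIdeal (n + 2) :=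
  le_antisymm (map_idealI01_le n) <|
    (map_idealI0 (n + 1)).symm.le.trans (Submodule.map_mono (idealI0_le_idealI01 n))

end PeakAlgebra

end

theorem mainTheorem3 :
    (∀ n : ℕ, (PeakAlgebra.idealI0 n).map (PeakAlgebra.phi (n + 1)) =
      PeakAlgebra.peakIdeal (n + 1)) ∧
    (∀ n : ℕ, (PeakAlgebra.idealI01 n).map (PeakAlgebra.phi (n + 2)) =
      PeakAlgebra.peakIdeal (n + 2)) :=
  ⟨PeakAlgebra.map_idealI0, PeakAlgebra.map_idealI01⟩
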